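/- For a finite group $G$ let $L(G)$ be the set of subgroups of $G$ and $L_1(G)$ the set of cyclic subgroups of $G$, and put $$sd(G)=\frac{|\{(H,K)\in L(G)^2 : HK=KH\}|}{|L(G)|^2},\qquad csd(G)=\frac{|\{(H,K)\in L_1(G)^2 : HK=KH\}|}{|L_1(G)|^2}.$$ For positive integers $m,n$ and a non-negative integer $r$ with $\gcd(m,n)=\gcd(m,r-1)=1$ and $r^n\equiv 1 \pmod m$, let $ZM(m,n,r)$ be the (finite) group $$ZM(m,n,r)=\langle a,b \mid a^m=b^n=1,\ b^{-1}ab=a^r\rangle .$$ Let $n$ and $p\ge 3$ be prime numbers. For every integer $\alpha\ge 1$ let $r_\alpha$ be a non-negative integer such that $\gcd(p^\alpha,n)=\gcd(p^\alpha,r_\alpha-1)=1$ and $r_\alpha^n\equiv 1 \pmod{p^\alpha}$. Then $$\text{(i)}\quad \lim_{\alpha\to\infty} sd(ZM(p^\alpha,n,r_\alpha))=0,\qquad \text{(ii)}\quad \lim_{\alpha\to\infty} csd(ZM(p^\alpha,n,r_\alpha))=0.$$ -/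

import Mathlib

open scoped Pointwise

/-- The subgroup commutativity degree of a (finite) group `G`: the proportion of the pairs
`(H, K)` of subgroups of `G` such that `HK = KH` as subsets of `G`. -/
noncomputable def subgroupCommDegree (G : Type*) [Group G] : ℝ :=
  (Nat.card {P : Subgroup G × Subgroup G //
      (P.1 : Set G) * (P.2 : Set G) = (P.2 : Set G) * (P.1 : Set G)} : ℝ) /
    (Nat.card (Subgroup G) : ℝ) ^ 2

/-- The cyclic subgroup commutativity degree of a (finite) group `G`: the proportion of the pairs
`(H, K)` of cyclic subgroups of `G` such that `HK = KH` as subsets of `G`. -/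
noncomputable def cyclicSubgroupCommDegree (G : Type*) [Group G] : ℝ :=
  (Nat.card {P : Subgroup G × Subgroup G // (IsCyclic P.1 ∧ IsCyclic P.2) ∧
      (P.1 : Set G) * (P.2 : Set G) = (P.2 : Set G) * (P.1 : Set G)} : ℝ) /
    (Nat.card {H : Subgroup G // IsCyclic H} : ℝ) ^ 2

/-- The admissible parameters of a ZM-group: `(m, n) = (m, r - 1) = 1` and `r ^ n ≡ 1 (mod m)`,
for positive `m` and `n`. The difference `r - 1` is taken in `ℤ`. -/
structure IsZMTriple (m n r : ℕ) : Prop where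
  m_pos : 0 < m
  n_pos : 0 < n
  coprime_m_n : Nat.Coprime m n
  coprime_m_r_sub_one : IsCoprime (m : ℤ) ((r : ℤ) - 1)
  pow_modEq_one : r ^ n ≡ 1 [MOD m]

/-- The relators `a ^ m`, `b ^ n`, `b⁻¹ * a * b * (a ^ r)⁻¹`, where `a` and `b` are the free
generators indexed by `0` and `1`. -/
def zmRelators (m n r : ℕ) : Set (FreeGroup (Fin 2)) :=
  {FreeGroup.of 0 ^ m,
   FreeGroup.of 1 ^ n,
   (FreeGroup.of 1)⁻¹ * FreeGroup.of 0 * FreeGroup.of 1 * (FreeGroup.of 0 ^ r)⁻¹}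

/-- The group `⟨a, b | a ^ m = b ^ n = 1, b⁻¹ a b = a ^ r⟩`. -/
abbrev ZMGroup (m n r : ℕ) : Type := PresentedGroup (zmRelators m n r)

/-! The subgroup `A = ⟨a⟩` is cyclic and normal, of order `p ^ α` and prime index `n ≠ p`, so its
subgroups form a chain of at most `α + 1`. If `H` and `K` permute and neither lies in `A`, comparing
the order of `HK` with that of `G` forces them to meet outside `A`; then one is the join of the
other with a subgroup of `A`. Hence a family `F` has at most `4 (α + 1) |F|` permuting pairs
(`card_mul_comm_pairs_le`). Since `b` fixes no nontrivial element of `A`, there are at least `p ^ α`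
cyclic subgroups (`card_le_ncard_isCyclic`). Both degrees are therefore at most `4 (α + 1) / p ^ α`.
-/

namespace Subgroup

/-! ### Permuting subgroups and cyclic normal subgroups of prime index -/

variable {G : Type*} [Group G]

/-- Two permuting subgroups have their product set equal to their join. -/
theorem coe_sup_eq_mul_of_mul_comm {H K : Subgroup G}
    (h : (H : Set G) * (K : Set G) = (K : Set G) * (H : Set G)) :
    ((H ⊔ K : Subgroup G) : Set G) = (H : Set G) * (K : Set G) := by
  apply Set.Subset.antisymm
  · let M : Subgroup G :=
      { carrier := (H : Set G) * (K : Set G)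
        one_mem' := ⟨1, H.one_mem, 1, K.one_mem, one_mul 1⟩
        mul_mem' := by
          intro x y hx hy
          have key : ((H : Set G) * K) * ((H : Set G) * K) = (H : Set G) * K := by
            rw [mul_assoc, ← mul_assoc (K : Set G), ← h, mul_assoc (H : Set G) K K, ← mul_assoc]
            simp
          rw [← key]
          exact Set.mul_mem_mul hx hy
        inv_mem' := by
          rintro _ ⟨x, hx, y, hy, rfl⟩
          change (x * y)⁻¹ ∈ (H : Set G) * K
          rw [h, mul_inv_rev]
          exact Set.mul_mem_mul (K.inv_mem hy) (H.inv_mem hx) }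
    have hM : H ⊔ K ≤ M := sup_le
      (fun x hx => ⟨x, hx, 1, K.one_mem, mul_one x⟩) (fun x hx => ⟨1, H.one_mem, x, hx, one_mul x⟩)
    exact hM
  · exact mul_subset (fun x hx => mem_sup_left hx) (fun x hx => mem_sup_right hx)

/-- The product formula for the product set of two subgroups. -/
theorem card_coe_mul_coe (H K : Subgroup G) :
    Nat.card ((H : Set G) * (K : Set G) : Set G) = Nat.card K * K.relIndex H := by
  rw [card_mul_eq_card_subgroup_mul_card_quotient]
  congr 1
  -- The cosets of `K` met by `H` form the `H`-orbit of the trivial coset, with stabilizer `H ⊓ K`.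
  have h1 : (QuotientGroup.mk '' (H : Set G) : Set (G ⧸ K)) =
      MulAction.orbit H ((1 : G) : G ⧸ K) := by
    ext x
    constructor
    · rintro ⟨y, hy, rfl⟩
      refine ⟨⟨y, hy⟩, ?_⟩
      change ((y * 1 : G) : G ⧸ K) = _
      rw [mul_one]
    · rintro ⟨⟨y, hy⟩, rfl⟩
      refine ⟨y, hy, ?_⟩
      change _ = ((y * 1 : G) : G ⧸ K)
      rw [mul_one]
  have h2 : MulAction.stabilizer H ((1 : G) : G ⧸ K) = K.subgroupOf H := by
    ext ⟨y, hy⟩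
    rw [MulAction.mem_stabilizer_iff, mem_subgroupOf]
    change ((y * 1 : G) : G ⧸ K) = ((1 : G) : G ⧸ K) ↔ y ∈ K
    rw [mul_one, QuotientGroup.eq, mul_one, inv_mem_iff]
  rw [h1, relIndex, ← h2, MulAction.index_stabilizer, Nat.card_coe_set_eq]

theorem pow_natCard_eq_one_of_mem {H : Subgroup G} {x : G} (hx : x ∈ H) : x ^ Nat.card H = 1 :=
  congrArg Subtype.val (pow_card_eq_one' (x := (⟨x, hx⟩ : H)))

theorem relIndex_eq_of_index_prime {A H : Subgroup G} [A.Normal] {n : ℕ} (hn : n.Prime)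
    (hA : A.index = n) (hH : ¬ H ≤ A) : A.relIndex H = n := by
  have h : A.relIndex H ∣ n := hA ▸ relIndex_dvd_index_of_normal A H
  exact ((Nat.dvd_prime hn).1 h).resolve_left fun h1 => hH (relIndex_eq_one.1 h1)

/-- `H ⊓ A` has prime index in `H`, hence is maximal there, and `H ⊓ L` contains it strictly because
of `g`. -/
theorem le_of_inf_le_of_index_prime {A H L : Subgroup G} [A.Normal] (hA : A.index.Prime)
    (hL : H ⊓ A ≤ L) {g : G} (hgH : g ∈ H) (hgL : g ∈ L) (hgA : g ∉ A) : H ≤ L := by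
  have hH : A.relIndex H = A.index := relIndex_eq_of_index_prime hA rfl fun h => hgA (h hgH)
  have h1 := relIndex_mul_relIndex (H ⊓ A) (H ⊓ L) H (le_inf inf_le_left hL) inf_le_left
  rw [inf_relIndex_left, inf_relIndex_left, hH] at h1
  rcases (Nat.dvd_prime hA).1 (Dvd.intro _ h1) with h2 | h2
  · exact absurd (relIndex_eq_one.1 h2 ⟨hgH, hgL⟩).2 hgA
  · rw [h2] at h1
    exact relIndex_eq_one.1 (Nat.eq_of_mul_eq_mul_left hA.pos (h1.trans (mul_one _).symm))

/-- In a cyclic group `x ^ |V| = 1` has at most `|V|` solutions, so `V` is the whole solution set,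
and it contains `U`. -/
theorem le_of_card_dvd_card_of_isCyclic {A U V : Subgroup G} [Finite A] [IsCyclic A]
    (hU : U ≤ A) (hV : V ≤ A) (h : Nat.card U ∣ Nat.card V) : U ≤ V := by
  classical
  have := Fintype.ofFinite A
  have hVf : Finite V := Finite.of_injective (inclusion hV) (inclusion_injective hV)
  have hV0 : 0 < Nat.card V := Nat.card_pos
  have hle := IsCyclic.card_pow_eq_one_le (α := A) hV0
  set T : Finset A := Finset.univ.filter fun x => x ^ Nat.card V = 1 with hT
  set S : Finset A := Finset.univ.filter fun x => (x : G) ∈ V with hS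
  have hST : S ⊆ T := by
    intro x hx
    simp only [hS, hT, Finset.mem_filter, Finset.mem_univ, true_and] at hx ⊢
    exact Subtype.ext (pow_natCard_eq_one_of_mem hx)
  have hcard : Nat.card V ≤ S.card := by
    have hinj : Function.Injective fun x : V =>
        (⟨inclusion hV x, by simp [hS]⟩ : S) := fun x y hxy =>
      inclusion_injective hV (congrArg Subtype.val hxy)
    simpa using Nat.card_le_card_of_injective _ hinj
  have heq : S = T := Finset.eq_of_subset_of_card_le hST (hle.trans hcard)
  intro x hx
  have hxT : (⟨x, hU hx⟩ : A) ∈ T := by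
    simp only [hT, Finset.mem_filter, Finset.mem_univ, true_and]
    obtain ⟨k, hk⟩ := h
    apply Subtype.ext
    change x ^ Nat.card V = 1
    rw [hk, pow_mul, pow_natCard_eq_one_of_mem hx, one_pow]
  rw [← heq] at hxT
  simpa [hS] using hxT

theorem card_le_of_isCyclic_prime_pow {A : Subgroup G} [IsCyclic A] {p α : ℕ} (hp : p.Prime)
    (hA : Nat.card A = p ^ α) : Nat.card {U : Subgroup G // U ≤ A} ≤ α + 1 := by
  have : Finite A := Nat.finite_of_card_ne_zero (hA ▸ pow_ne_zero _ hp.ne_zero)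
  have hd : ∀ U : {U : Subgroup G // U ≤ A}, Nat.card U.1 ∈ (p ^ α).divisors := fun U =>
    Nat.mem_divisors.2 ⟨hA ▸ card_dvd_of_le U.2, pow_ne_zero _ hp.ne_zero⟩
  have hinj : Function.Injective fun U : {U : Subgroup G // U ≤ A} =>
      (⟨Nat.card U.1, hd U⟩ : (p ^ α).divisors) := by
    intro U V h
    have h : Nat.card U.1 = Nat.card V.1 := congrArg Subtype.val h
    exact Subtype.ext (le_antisymm (le_of_card_dvd_card_of_isCyclic U.2 V.2 h.dvd)
      (le_of_card_dvd_card_of_isCyclic V.2 U.2 h.symm.dvd))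
  refine (Nat.card_le_card_of_injective _ hinj).trans_eq ?_
  rw [Nat.card_eq_fintype_card, Fintype.card_coe, Nat.divisors_prime_pow hp]
  simp

/-- Permuting subgroups that are not contained in `A` meet outside `A`, when `A` is a normal Hall
subgroup of prime index. -/
theorem not_inf_le_of_mul_comm [Finite G] {A H K : Subgroup G} [A.Normal] (hA : A.index.Prime)
    (hcop : (Nat.card A).Coprime A.index)
    (h : (H : Set G) * (K : Set G) = (K : Set G) * (H : Set G))
    (hH : ¬ H ≤ A) (hK : ¬ K ≤ A) : ¬ H ⊓ K ≤ A := by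
  intro hle
  have dvd {L : Subgroup G} (hL : ¬ L ≤ A) : A.index ∣ Nat.card L := by
    rw [← relIndex_eq_of_index_prime hA rfl hL]
    exact relIndex_dvd_card A L
  have h1 : Nat.card (H ⊔ K : Subgroup G) = Nat.card K * K.relIndex H := by
    rw [← card_coe_mul_coe, ← coe_sup_eq_mul_of_mul_comm h]
    rfl
  have h2 : Nat.card (H ⊓ K : Subgroup G) * K.relIndex H = Nat.card H := by
    rw [← relIndex_bot_left, ← relIndex_bot_left, ← inf_relIndex_left H K]
    exact relIndex_mul_relIndex _ _ _ bot_le inf_le_left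
  -- If `H ⊓ K ≤ A`, its order is coprime to the index `n` of `A`, so `n` divides `[H : H ⊓ K]` and
  -- `n ^ 2` divides `|HK|`, hence `|G| = |A| n`.
  have h3 : A.index ∣ K.relIndex H :=
    (Nat.Coprime.coprime_dvd_left (card_dvd_of_le hle) hcop).symm.dvd_of_dvd_mul_left
      (h2 ▸ dvd hH)
  have h4 : A.index * A.index ∣ Nat.card A * A.index := by
    rw [card_mul_index]
    exact (h1 ▸ mul_dvd_mul (dvd hK) h3).trans (card_subgroup_dvd_card _)
  have h5 : A.index ∣ Nat.card A := Nat.dvd_of_mul_dvd_mul_right hA.pos h4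
  exact hA.one_lt.ne' (Nat.Coprime.eq_one_of_dvd hcop.symm h5)

theorem eq_sup_inf_of_index_prime {A H K : Subgroup G} [A.Normal] (hA : A.index.Prime)
    (hle : H ⊓ A ≤ K ⊓ A) {g : G} (hgH : g ∈ H) (hgK : g ∈ K) (hgA : g ∉ A) :
    K = H ⊔ (K ⊓ A) := by
  apply le_antisymm
  · exact le_of_inf_le_of_index_prime hA le_sup_right hgK (mem_sup_left hgH) hgA
  · exact sup_le (le_of_inf_le_of_index_prime hA (hle.trans inf_le_left) hgH hgK hgA) inf_le_left

theorem le_or_eq_sup_of_mul_comm [Finite G] {A H K : Subgroup G} [A.Normal] [IsCyclic A]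
    {p α : ℕ} (hp : p.Prime) (hAp : Nat.card A = p ^ α) (hA : A.index.Prime)
    (hcop : (Nat.card A).Coprime A.index)
    (h : (H : Set G) * (K : Set G) = (K : Set G) * (H : Set G)) :
    H ≤ A ∨ K ≤ A ∨ (∃ W ≤ A, K = H ⊔ W) ∨ ∃ W ≤ A, H = K ⊔ W := by
  by_cases hH : H ≤ A
  · exact Or.inl hH
  by_cases hK : K ≤ A
  · exact Or.inr (Or.inl hK)
  obtain ⟨g, hg, hgA⟩ := SetLike.not_le_iff_exists.1 (not_inf_le_of_mul_comm hA hcop h hH hK)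
  have hd (L : Subgroup G) : ∃ k, Nat.card (L ⊓ A : Subgroup G) = p ^ k := by
    obtain ⟨k, -, hk⟩ := (Nat.dvd_prime_pow hp).1
      (hAp ▸ card_dvd_of_le (inf_le_right : L ⊓ A ≤ A))
    exact ⟨k, hk⟩
  obtain ⟨i, hi⟩ := hd H
  obtain ⟨j, hj⟩ := hd K
  -- Both intersections with `A` have `p`-power order, so one contains the other.
  refine Or.inr (Or.inr ((le_total i j).imp (fun hij => ?_) fun hij => ?_))
  · exact ⟨K ⊓ A, inf_le_right, eq_sup_inf_of_index_prime hA (le_of_card_dvd_card_of_isCyclic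
      inf_le_right inf_le_right (hi ▸ hj ▸ pow_dvd_pow p hij)) hg.1 hg.2 hgA⟩
  · exact ⟨H ⊓ A, inf_le_right, eq_sup_inf_of_index_prime hA (le_of_card_dvd_card_of_isCyclic
      inf_le_right inf_le_right (hi ▸ hj ▸ pow_dvd_pow p hij)) hg.2 hg.1 hgA⟩

/-- A bound for the number of permuting pairs in a family of subgroups. -/
theorem card_mul_comm_pairs_le [Finite G] {A : Subgroup G} [A.Normal] [IsCyclic A]
    {p α : ℕ} (hp : p.Prime) (hAp : Nat.card A = p ^ α) (hA : A.index.Prime)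
    (hcop : (Nat.card A).Coprime A.index) (F : Set (Subgroup G)) :
    {P : Subgroup G × Subgroup G | (P.1 ∈ F ∧ P.2 ∈ F) ∧
      (P.1 : Set G) * (P.2 : Set G) = (P.2 : Set G) * (P.1 : Set G)}.ncard ≤
      4 * ((α + 1) * F.ncard) := by
  set S : Set (Subgroup G) := {U | U ≤ A}
  have hS : S.ncard ≤ α + 1 := card_le_of_isCyclic_prime_pow hp hAp
  set R : Set (Subgroup G × Subgroup G) := S ×ˢ F
  have hR : R.ncard ≤ (α + 1) * F.ncard := by
    rw [Set.ncard_prod]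
    gcongr
  have him (f : Subgroup G × Subgroup G → Subgroup G × Subgroup G) :
      (f '' R).ncard ≤ (α + 1) * F.ncard := (Set.ncard_image_le (Set.toFinite R)).trans hR
  -- One image of `R` for each alternative of `le_or_eq_sup_of_mul_comm`.
  refine (Set.ncard_le_ncard (t := ((fun x => x) '' R ∪ (fun x => (x.2, x.1)) '' R) ∪
    ((fun x => (x.2, x.2 ⊔ x.1)) '' R ∪ (fun x => (x.2 ⊔ x.1, x.2)) '' R)) ?_
    (Set.toFinite _)).trans ?_
  · rintro ⟨H, K⟩ ⟨⟨hH, hK⟩, h⟩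
    rcases le_or_eq_sup_of_mul_comm hp hAp hA hcop h with h | h | ⟨W, hW, h⟩ | ⟨W, hW, h⟩
    · exact Or.inl (Or.inl ⟨(H, K), ⟨h, hK⟩, rfl⟩)
    · exact Or.inl (Or.inr ⟨(K, H), ⟨h, hH⟩, rfl⟩)
    · exact Or.inr (Or.inl ⟨(W, H), ⟨hW, hH⟩, by simp only [← h]⟩)
    · exact Or.inr (Or.inr ⟨(W, K), ⟨hW, hK⟩, by simp only [← h]⟩)
  · have h1 := him fun x => x
    have h2 := him fun x => (x.2, x.1)
    have h3 := him fun x => (x.2, x.2 ⊔ x.1)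
    have h4 := him fun x => (x.2 ⊔ x.1, x.2)
    refine (Set.ncard_union_le _ _).trans ?_
    refine (add_le_add (Set.ncard_union_le _ _) (Set.ncard_union_le _ _)).trans ?_
    omega

/-- An element acting on `A` without fixed points has at least `|A|` conjugates of the subgroup it
generates. -/
theorem card_le_ncard_isCyclic [Finite G] {A : Subgroup G} [A.Normal] {n : ℕ}
    (hcop : (Nat.card A).Coprime n) {b : G} (hbn : b ^ n = 1)
    (hb : ∀ x ∈ A, b * x = x * b → x = 1) :
    Nat.card A ≤ {H : Subgroup G | IsCyclic H}.ncard := by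
  let f : A → {H : Subgroup G | IsCyclic H} := fun x =>
    ⟨zpowers ((x : G) * b * (x : G)⁻¹), isCyclic_zpowers _⟩
  refine (Nat.card_le_card_of_injective f ?_).trans_eq (Nat.card_coe_set_eq _)
  rintro ⟨x, hx⟩ ⟨y, hy⟩ hxy
  have h : zpowers (x * b * x⁻¹) = zpowers (y * b * y⁻¹) := congrArg Subtype.val hxy
  have hmem : x * b * x⁻¹ ∈ zpowers (y * b * y⁻¹) := h ▸ mem_zpowers _
  obtain ⟨k, hk⟩ := mem_zpowers_iff.1 hmem
  rw [conj_zpow] at hk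
  set z := y⁻¹ * x with hz
  have hzA : z ∈ A := A.mul_mem (A.inv_mem hy) hx
  have hzb : z * b * z⁻¹ = b ^ k := by
    have : z * b * z⁻¹ = y⁻¹ * (x * b * x⁻¹) * y := by rw [hz]; group
    rw [this, ← hk]
    group
  -- This element is the commutator of `z` and `b`. It lies in `A` and is a power of `b`, so coprime
  -- exponents kill it and `z` commutes with `b`.
  have hwA : b ^ k * b⁻¹ ∈ A := by
    rw [← hzb, mul_assoc, mul_assoc, ← mul_assoc b]
    exact A.mul_mem hzA (Normal.conj_mem ‹_› _ (A.inv_mem hzA) b)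
  have hw1 : (b ^ k * b⁻¹) ^ n = 1 := by
    rw [← zpow_sub_one, ← zpow_natCast, zpow_comm, zpow_natCast, hbn, one_zpow]
  have hw2 : (b ^ k * b⁻¹) ^ Nat.card A = 1 := pow_natCard_eq_one_of_mem hwA
  have hw : b ^ k * b⁻¹ = 1 := by
    have := pow_gcd_eq_one.2 ⟨hw2, hw1⟩
    rwa [hcop.gcd_eq_one, pow_one] at this
  have hz1 : z = 1 := by
    apply hb z hzA
    rw [← hzb] at hw
    have := mul_inv_eq_one.1 hw
    exact (mul_inv_eq_iff_eq_mul.1 this).symm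
  exact Subtype.ext (inv_mul_eq_one.1 hz1).symm

end Subgroup

/-! ### Structure of the groups `ZM(m, n, r)` -/

namespace ZMGroup

variable {m n r : ℕ}

/-- The generator `a` of `ZM(m, n, r)`. -/
def a (m n r : ℕ) : ZMGroup m n r := PresentedGroup.of 0

/-- The generator `b` of `ZM(m, n, r)`. -/
def b (m n r : ℕ) : ZMGroup m n r := PresentedGroup.of 1

theorem a_pow : a m n r ^ m = 1 :=
  PresentedGroup.one_of_mem (rels := zmRelators m n r) (x := FreeGroup.of 0 ^ m)
    (by simp [zmRelators])

theorem b_pow : b m n r ^ n = 1 :=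
  PresentedGroup.one_of_mem (rels := zmRelators m n r) (x := FreeGroup.of 1 ^ n)
    (by simp [zmRelators])

theorem conj_a : (b m n r)⁻¹ * a m n r * b m n r = a m n r ^ r :=
  mul_inv_eq_one.1 <| PresentedGroup.one_of_mem (rels := zmRelators m n r)
    (x := (FreeGroup.of 1)⁻¹ * FreeGroup.of 0 * FreeGroup.of 1 * (FreeGroup.of 0 ^ r)⁻¹)
    (by simp [zmRelators])

theorem conj_of_mem_zpowers {x : ZMGroup m n r} (hx : x ∈ Subgroup.zpowers (a m n r)) :
    (b m n r)⁻¹ * x * b m n r = x ^ r := by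
  obtain ⟨k, rfl⟩ := Subgroup.mem_zpowers_iff.1 hx
  have h := conj_zpow (i := k) (a := (b m n r)⁻¹) (b := a m n r)
  rw [inv_inv] at h
  rw [← h, conj_a, ← zpow_natCast, ← zpow_natCast, zpow_comm]

theorem pow_conj_of_mem_zpowers {x : ZMGroup m n r} (hx : x ∈ Subgroup.zpowers (a m n r)) (k : ℕ) :
    (b m n r ^ k)⁻¹ * x * b m n r ^ k = x ^ r ^ k := by
  induction k with
  | zero => simp
  | succ k ih =>
    have h : (b m n r ^ (k + 1))⁻¹ * x * b m n r ^ (k + 1) =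
        (b m n r)⁻¹ * ((b m n r ^ k)⁻¹ * x * b m n r ^ k) * b m n r := by
      rw [pow_succ]; group
    rw [h, ih, conj_of_mem_zpowers (pow_mem hx _), ← pow_mul, ← pow_succ]

theorem eq_top_of_mem {H : Subgroup (ZMGroup m n r)} (ha : a m n r ∈ H) (hb : b m n r ∈ H) :
    H = ⊤ := by
  rw [Subgroup.eq_top_iff']
  apply PresentedGroup.generated_by
  intro j
  fin_cases j
  · exact ha
  · exact hb

theorem normal_zpowers (hn : n ≠ 0) : (Subgroup.zpowers (a m n r)).Normal := by
  rw [← Subgroup.normalizer_eq_top_iff]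
  apply eq_top_of_mem
  · exact Subgroup.le_normalizer (Subgroup.mem_zpowers _)
  · rw [Subgroup.mem_normalizer_iff'']
    refine fun x => ⟨fun hx => ?_, fun hx => ?_⟩
    · rw [conj_of_mem_zpowers hx]
      exact pow_mem hx _
    -- Conjugation by `b` is undone by conjugation by `b ^ (n - 1) = b⁻¹`.
    · have h := pow_conj_of_mem_zpowers hx (n - 1)
      have hb : b m n r ^ (n - 1) = (b m n r)⁻¹ := by
        rw [eq_inv_iff_mul_eq_one, ← pow_succ, Nat.sub_add_cancel (Nat.pos_of_ne_zero hn), b_pow]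
      have h' : x = (b m n r ^ (n - 1))⁻¹ * ((b m n r)⁻¹ * x * b m n r) * b m n r ^ (n - 1) := by
        rw [hb]; group
      rw [h', h]
      exact pow_mem hx _

/-- The action of `ZM(m, n, r)` on `ℤ/m` by affine permutations. -/
def toPerm (u : (ZMod m)ˣ) (hu : (u : ZMod m) = r) (hun : u ^ n = 1) :
    ZMGroup m n r →* Equiv.Perm (ZMod m) :=
  -- Permutations compose right to left, so `b` must act as `u⁻¹` for `b⁻¹ a b` to be translation by
  -- `u = r`.
  PresentedGroup.toGroup (f := ![Equiv.addRight 1, MulAction.toPermHom (ZMod m)ˣ (ZMod m) u⁻¹]) <| by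
    have hpow (k : ℕ) (x : ZMod m) : ((Equiv.addRight (1 : ZMod m)) ^ k) x = x + k := by
      simp
    rintro _ (rfl | rfl | rfl)
    · ext x
      simp
    · simp only [map_pow, FreeGroup.lift_apply_of, Matrix.cons_val_one, Matrix.cons_val_zero]
      rw [← map_pow, inv_pow, hun, inv_one, map_one]
    · simp only [map_mul, map_inv, map_pow, FreeGroup.lift_apply_of, Matrix.cons_val_one,
        Matrix.cons_val_zero]
      rw [mul_inv_eq_one]
      ext x
      rw [hpow, inv_inv]
      change u • (u⁻¹ • x + 1) = _
      rw [smul_add, smul_inv_smul, Units.smul_def, smul_eq_mul, mul_one, hu]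

/-- The relators could a priori collapse `a`; its action on `ZMod m` as translation by `1` excludes
this. -/
theorem orderOf_a (h : IsZMTriple m n r) : orderOf (a m n r) = m := by
  apply Nat.dvd_antisymm (orderOf_dvd_of_pow_eq_one a_pow)
  have hr : (r : ZMod m) ^ n = 1 := by
    have := (ZMod.natCast_eq_natCast_iff _ _ _).2 h.pow_modEq_one
    simpa using this
  let u : (ZMod m)ˣ := Units.ofPowEqOne (r : ZMod m) n hr h.n_pos.ne'
  let φ := toPerm u rfl (Units.pow_ofPowEqOne hr h.n_pos.ne')
  have hφ : φ (a m n r) = Equiv.addRight 1 := PresentedGroup.toGroup.of _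
  have h1 : φ (a m n r ^ orderOf (a m n r)) 0 = 0 := by
    rw [pow_orderOf_eq_one, map_one, Equiv.Perm.one_apply]
  rw [map_pow, hφ] at h1
  rw [← ZMod.natCast_eq_zero_iff]
  simpa using h1

/-- Such an `x` satisfies `x ^ r = x`, so it is killed by the coprime exponents `m` and `r - 1`. -/
theorem eq_one_of_commute (h : IsZMTriple m n r) {x : ZMGroup m n r}
    (hx : x ∈ Subgroup.zpowers (a m n r)) (hbx : b m n r * x = x * b m n r) : x = 1 := by
  have h1 : x ^ (m : ℤ) = 1 := by
    obtain ⟨k, rfl⟩ := Subgroup.mem_zpowers_iff.1 hx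
    rw [zpow_comm, zpow_natCast, a_pow, one_zpow]
  have h2 : x ^ ((r : ℤ) - 1) = 1 := by
    rw [zpow_sub_one, zpow_natCast, ← conj_of_mem_zpowers hx, mul_assoc _ x, ← hbx]
    group
  obtain ⟨c, d, hcd⟩ := h.coprime_m_r_sub_one
  rw [← zpow_one x, ← hcd, zpow_add, mul_comm c, mul_comm d, zpow_mul, zpow_mul, h1, h2]
  simp

theorem index_zpowers (h : IsZMTriple m n r) (hm : m ≠ 1) (hn : n.Prime) :
    (Subgroup.zpowers (a m n r)).index = n := by
  have := normal_zpowers (m := m) (r := r) hn.ne_zero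
  set A := Subgroup.zpowers (a m n r) with hA
  set β : ZMGroup m n r ⧸ A := QuotientGroup.mk' A (b m n r) with hβ
  have htop : (Subgroup.zpowers β).comap (QuotientGroup.mk' A) = ⊤ := by
    apply eq_top_of_mem
    · have : QuotientGroup.mk' A (a m n r) = 1 :=
        (QuotientGroup.eq_one_iff _).2 (Subgroup.mem_zpowers _)
      rw [Subgroup.mem_comap, this]
      exact one_mem _
    · exact Subgroup.mem_zpowers β
  have htop' : Subgroup.zpowers β = ⊤ := by
    rw [← Subgroup.map_comap_eq_self_of_surjective (QuotientGroup.mk'_surjective A)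
      (Subgroup.zpowers β), htop, Subgroup.map_top_of_surjective _ (QuotientGroup.mk'_surjective A)]
  have hβn : β ^ n = 1 := by rw [hβ, ← map_pow, b_pow, map_one]
  rw [Subgroup.index_eq_card, ← orderOf_eq_card_of_zpowers_eq_top htop']
  -- If `β` were trivial, `b` would be a power of `a` and commute with it, forcing `a = 1` and `m =
  -- 1`.
  refine ((Nat.dvd_prime hn).1 (orderOf_dvd_of_pow_eq_one hβn)).resolve_left fun h1 => hm ?_
  have hbA : b m n r ∈ A := (QuotientGroup.eq_one_iff _).1 (orderOf_eq_one_iff.1 h1)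
  obtain ⟨k, hk⟩ := Subgroup.mem_zpowers_iff.1 hbA
  have ha : a m n r = 1 := by
    refine eq_one_of_commute h (Subgroup.mem_zpowers _) ?_
    rw [← hk]
    exact ((Commute.refl (a m n r)).zpow_left k).eq
  rw [← orderOf_a h, ha, orderOf_one]

/-! ### Bounds for the two degrees and their limits -/

variable {p α : ℕ}

theorem exists_bounds (hn : n.Prime) (hp : p.Prime) (hα : 1 ≤ α) (h : IsZMTriple (p ^ α) n r) :
    p ^ α ≤ {H : Subgroup (ZMGroup (p ^ α) n r) | IsCyclic H}.ncard ∧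
    Finite (ZMGroup (p ^ α) n r) ∧
    ∀ F : Set (Subgroup (ZMGroup (p ^ α) n r)),
      {P : Subgroup (ZMGroup (p ^ α) n r) × Subgroup (ZMGroup (p ^ α) n r) |
        (P.1 ∈ F ∧ P.2 ∈ F) ∧ (P.1 : Set (ZMGroup (p ^ α) n r)) * (P.2 : Set _) =
          (P.2 : Set _) * (P.1 : Set _)}.ncard ≤ 4 * ((α + 1) * F.ncard) := by
  have := normal_zpowers (m := p ^ α) (r := r) hn.ne_zero
  have hcard : Nat.card (Subgroup.zpowers (a (p ^ α) n r)) = p ^ α := by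
    rw [Nat.card_zpowers, orderOf_a h]
  have hidx : (Subgroup.zpowers (a (p ^ α) n r)).index = n :=
    index_zpowers h (Nat.one_lt_pow (by omega) hp.one_lt).ne' hn
  have hfin : Finite (ZMGroup (p ^ α) n r) := by
    apply Nat.finite_of_card_ne_zero
    rw [← (Subgroup.zpowers (a (p ^ α) n r)).card_mul_index, hcard, hidx]
    exact mul_ne_zero h.m_pos.ne' h.n_pos.ne'
  refine ⟨?_, hfin, ?_⟩
  · have := Subgroup.card_le_ncard_isCyclic (A := Subgroup.zpowers (a (p ^ α) n r)) (n := n)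
      (hcard.symm ▸ h.coprime_m_n) b_pow fun x hx => eq_one_of_commute h hx
    rwa [hcard] at this
  · exact Subgroup.card_mul_comm_pairs_le hp hcard (hidx.symm ▸ hn)
      (by rw [hcard, hidx]; exact h.coprime_m_n)

theorem div_sq_le {c k f q : ℕ} (hc : c ≤ 4 * (k * f)) (hq : 0 < q) (hf : q ≤ f) :
    (c : ℝ) / (f : ℝ) ^ 2 ≤ 4 * (k : ℝ) / (q : ℝ) := by
  have hf0 : (0 : ℝ) < f := by exact_mod_cast hq.trans_le hf
  have hq0 : (0 : ℝ) < q := by exact_mod_cast hq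
  have hf' : (q : ℝ) ≤ f := by exact_mod_cast hf
  have hc' : (c : ℝ) ≤ 4 * (k * f) := by exact_mod_cast hc
  calc (c : ℝ) / (f : ℝ) ^ 2 ≤ 4 * (k * f) / (f : ℝ) ^ 2 := by gcongr
    _ = 4 * (k : ℝ) / (f : ℝ) := by field_simp
    _ ≤ 4 * (k : ℝ) / (q : ℝ) := by gcongr

theorem subgroupCommDegree_le (hn : n.Prime) (hp : p.Prime) (hα : 1 ≤ α)
    (h : IsZMTriple (p ^ α) n r) :
    subgroupCommDegree (ZMGroup (p ^ α) n r) ≤ 4 * (α + 1 : ℕ) / (p ^ α : ℕ) := by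
  obtain ⟨hle, hfin, hF⟩ := exists_bounds hn hp hα h
  refine div_sq_le ?_ h.m_pos (hle.trans ?_)
  · have := hF Set.univ
    simp only [Set.mem_univ, true_and, Set.ncard_univ] at this
    exact this
  · rw [← Set.ncard_univ]
    exact Set.ncard_le_ncard (Set.subset_univ _) (Set.toFinite _)

theorem cyclicSubgroupCommDegree_le (hn : n.Prime) (hp : p.Prime) (hα : 1 ≤ α)
    (h : IsZMTriple (p ^ α) n r) :
    cyclicSubgroupCommDegree (ZMGroup (p ^ α) n r) ≤ 4 * (α + 1 : ℕ) / (p ^ α : ℕ) := by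
  obtain ⟨hle, hfin, hF⟩ := exists_bounds hn hp hα h
  exact div_sq_le (hF {H | IsCyclic H}) h.m_pos hle

end ZMGroup

theorem tendsto_four_mul_succ_div_pow {p : ℕ} (hp : 1 < p) :
    Filter.Tendsto (fun α : ℕ => (4 * (α + 1 : ℕ) / (p ^ α : ℕ) : ℝ)) Filter.atTop (nhds 0) := by
  have hp' : (1 : ℝ) < p := by exact_mod_cast hp
  have h1 := tendsto_pow_const_div_const_pow_of_one_lt 1 hp'
  have h0 := tendsto_pow_const_div_const_pow_of_one_lt 0 hp'
  have h := (h1.add h0).const_mul 4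
  rw [add_zero, mul_zero] at h
  refine h.congr fun α => ?_
  push_cast
  ring

theorem corollary4p6 (n p : ℕ) (hn : n.Prime) (hp : p.Prime) (hp3 : 3 ≤ p)
    (r : ℕ → ℕ) (hr : ∀ α : ℕ, 1 ≤ α → IsZMTriple (p ^ α) n (r α)) :
    Filter.Tendsto (fun α : ℕ => subgroupCommDegree (ZMGroup (p ^ α) n (r α)))
        Filter.atTop (nhds 0) ∧
      Filter.Tendsto (fun α : ℕ => cyclicSubgroupCommDegree (ZMGroup (p ^ α) n (r α)))
        Filter.atTop (nhds 0) := by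
  have hlim := tendsto_four_mul_succ_div_pow hp.one_lt
  constructor
  · refine squeeze_zero' (Filter.Eventually.of_forall fun α => ?_) ?_ hlim
    · unfold subgroupCommDegree
      positivity
    · filter_upwards [Filter.eventually_ge_atTop 1] with α hα
      exact ZMGroup.subgroupCommDegree_le hn hp hα (hr α hα)
  · refine squeeze_zero' (Filter.Eventually.of_forall fun α => ?_) ?_ hlim
    · unfold cyclicSubgroupCommDegree
      positivity
    · filter_upwards [Filter.eventually_ge_atTop 1] with α hα
      exact ZMGroup.cyclicSubgroupCommDegree_le hn hp hα (hr α hα)
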